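/- Let $q\ge 2$ and let $(e_n)_{n\in\mathbb Z}$ (the watermark of a multi-input system) be i.i.d. random vectors in $\mathbb R^q$ with mean zero, covariance matrix $\Sigma_e=\mathbb E[e_ne_n^\top]$, and $\|e_n\|\le K_e$ almost surely (Euclidean norm), for a constant $K_e$. For integers $k'\ge 0$ and $N\ge 1$ let $$\Phi^{(3)}_N=\frac1N\sum_{n=0}^{N-1}\bigl(e_{n-k'-1}e_{n-k'-1}^\top-\Sigma_e\bigr),\qquad c^{(3)}_N=\Bigl\|\sum_{k=0}^{N-1}\Bigl((K_e^2\mathbb I-\Sigma_e)^2+\mathbb E\bigl[(e_ke_k^\top)^2\bigr]-\Sigma_e^2\Bigr)\Bigr\|,$$ where $\|\cdot\|$ is the spectral norm of matrices. Then for every $k'\ge0$, every $N\ge 1$ and every $t\ge 0$, $$\mathrm P\bigl(\|\Phi^{(3)}_N\|\ge t\bigr)\le 2q\,\exp\!\Bigl(-\frac{N^2t^2}{c^{(3)}_N}\Bigr),$$ where, if $c^{(3)}_N=0$, the exponential is read as $0$ for $t>0$ and as $1$ for $t=0$. -/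

import Mathlib

open MeasureTheory ProbabilityTheory
open scoped Matrix Matrix.Norms.L2Operator

/- With the scope `Matrix.Norms.L2Operator` open, `‖A‖` for a real matrix `A` is its spectral norm
(the largest singular value). -/

noncomputable section

namespace DynamicWatermark

/-- The rank-one matrix `v vᵀ`. -/
def outer {q : ℕ} (v : EuclideanSpace ℝ (Fin q)) : Matrix (Fin q) (Fin q) ℝ :=
  Matrix.of fun i j => v i * v j

/-- The entrywise expectation `𝔼[M]` of a random matrix `M`. -/
def matrixExp {Ω : Type*} [MeasurableSpace Ω] (P : Measure Ω) {q : ℕ}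
    (M : Ω → Matrix (Fin q) (Fin q) ℝ) : Matrix (Fin q) (Fin q) ℝ :=
  Matrix.of fun i j => ∫ ω, M ω i j ∂P

/-- The covariance matrix of a random vector `X`. -/
def covMatrix {Ω : Type*} [MeasurableSpace Ω] (P : Measure Ω) {q : ℕ}
    (X : Ω → EuclideanSpace ℝ (Fin q)) : Matrix (Fin q) (Fin q) ℝ :=
  Matrix.of fun i j => covariance (fun ω => X ω i) (fun ω => X ω j) P

/-- The centered empirical covariance
`Φ⁽³⁾_N = (1/N) ∑_{n=0}^{N-1} (e_{n-k'-1} e_{n-k'-1}ᵀ - Σ_e)` of the watermark,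
where `Σ_e` is the common covariance matrix of the `e_n`. -/
def Phi3 {Ω : Type*} [MeasurableSpace Ω] (P : Measure Ω) {q : ℕ}
    (e : ℤ → Ω → EuclideanSpace ℝ (Fin q)) (k' N : ℕ) (ω : Ω) : Matrix (Fin q) (Fin q) ℝ :=
  (1 / (N : ℝ)) • ∑ n ∈ Finset.range N,
    (outer (e ((n : ℤ) - (k' : ℤ) - 1) ω) - covMatrix P (e 0))

/-- The constant
`c⁽³⁾_N = ‖∑_{k=0}^{N-1} ((K_e² I - Σ_e)² + 𝔼[(e_k e_kᵀ)²] - Σ_e²)‖`. -/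
def c3 {Ω : Type*} [MeasurableSpace Ω] (P : Measure Ω) {q : ℕ}
    (e : ℤ → Ω → EuclideanSpace ℝ (Fin q)) (Ke : ℝ) (N : ℕ) : ℝ :=
  ‖∑ k ∈ Finset.range N,
    ((Ke ^ 2 • (1 : Matrix (Fin q) (Fin q) ℝ) - covMatrix P (e 0)) ^ 2
      + matrixExp P (fun ω => outer (e (k : ℤ) ω) ^ 2) - covMatrix P (e 0) ^ 2)‖

end DynamicWatermark

end

/-! The bound follows from a matrix Hoeffding inequality with the sharp scalar constant. The
matrices `Y = e eᵀ / Ke²` lie between `0` and `1`, and for `N` i.i.d. such matrices the centered sum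
has norm at least `s` with probability at most `2q exp(-2s²/N)`. With `s = Nt/Ke²` the exponent is
`-2Nt²/Ke⁴`, which is at most `-N²t²/c3` because `c3 ≥ N Ke⁴/2` (`c3_lower_bound`, where `q ≥ 2`
enters).

The Hoeffding inequality is the matrix Laplace transform method. Lieb's concavity and Jensen replace
each random `θY` inside a trace exponential by `log(1 + (e^θ - 1) 𝔼Y)`, and Hoeffding's lemma for a
Bernoulli variable, applied to the eigenvalues of `𝔼Y`, bounds this by `θ 𝔼Y + θ²/8`.

Lieb's theorem comes from the variational formula `tr exp(H + log A) = max_M [tr(MH) - D(M, A) + tr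
A]` and the joint convexity of the relative entropy `D`. The latter holds because `D` is a positive
integral of functions, each a supremum of functionals linear in `(M, A)`. -/

namespace MatrixConcentration

open scoped MatrixOrder
open Filter Topology

/-! ### Traces in a pair of eigenbases -/

section Spectral

variable {n : Type*} [Fintype n] [DecidableEq n]

/-- The matrix of `Z` with respect to the eigenbases of two Hermitian matrices. -/
noncomputable def eigenCoeff {A B : Matrix n n ℝ} (hA : A.IsHermitian) (hB : B.IsHermitian)
    (Z : Matrix n n ℝ) : Matrix n n ℝ :=
  (hA.eigenvectorUnitary : Matrix n n ℝ)ᵀ * Z * (hB.eigenvectorUnitary : Matrix n n ℝ)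

theorem eigenvectorUnitary_transpose_mul {A : Matrix n n ℝ} (hA : A.IsHermitian) :
    (hA.eigenvectorUnitary : Matrix n n ℝ)ᵀ * (hA.eigenvectorUnitary : Matrix n n ℝ) = 1 := by
  have := Unitary.coe_star_mul_self hA.eigenvectorUnitary
  simpa [Matrix.star_eq_conjTranspose] using this

theorem cfc_eq_conj_diagonal {A : Matrix n n ℝ} (hA : A.IsHermitian) (f : ℝ → ℝ) :
    cfc f A = (hA.eigenvectorUnitary : Matrix n n ℝ) *
      Matrix.diagonal (fun i => f (hA.eigenvalues i)) *
      (hA.eigenvectorUnitary : Matrix n n ℝ)ᵀ := by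
  rw [hA.cfc_eq, Matrix.IsHermitian.cfc, Unitary.conjStarAlgAut_apply]
  simp [Matrix.star_eq_conjTranspose, Function.comp_def]

/-- This reduces trace identities for two non-commuting matrices to scalar ones, pair of eigenvalues
by pair. With `Y = Z = 1` the weights are squares, so scalar inequalities pass to traces. -/
theorem trace_cfc_mul_cfc {A B : Matrix n n ℝ} (hA : A.IsHermitian) (hB : B.IsHermitian)
    (f g : ℝ → ℝ) (Y Z : Matrix n n ℝ) :
    (cfc f A * Y * cfc g B * Zᵀ).trace =
      ∑ i, ∑ j, f (hA.eigenvalues i) * g (hB.eigenvalues j) *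
        (eigenCoeff hA hB Y i j * eigenCoeff hA hB Z i j) := by
  rw [cfc_eq_conj_diagonal hA, cfc_eq_conj_diagonal hB]
  set U := (hA.eigenvectorUnitary : Matrix n n ℝ) with hU
  set V := (hB.eigenvectorUnitary : Matrix n n ℝ) with hV
  have h1 : (U * Matrix.diagonal (fun i => f (hA.eigenvalues i)) * Uᵀ * Y *
      (V * Matrix.diagonal (fun i => g (hB.eigenvalues i)) * Vᵀ) * Zᵀ).trace =
      (Matrix.diagonal (fun i => f (hA.eigenvalues i)) * eigenCoeff hA hB Y *
        (Matrix.diagonal (fun i => g (hB.eigenvalues i)) * (eigenCoeff hA hB Z)ᵀ)).trace := by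
    simp only [eigenCoeff, ← hU, ← hV, Matrix.transpose_mul, Matrix.transpose_transpose]
    rw [Matrix.mul_assoc, Matrix.mul_assoc, Matrix.mul_assoc, Matrix.mul_assoc,
      Matrix.trace_mul_comm]
    simp only [Matrix.mul_assoc]
  rw [h1, Matrix.trace]
  refine Finset.sum_congr rfl fun i _ => ?_
  rw [Matrix.diag_apply, Matrix.mul_apply]
  refine Finset.sum_congr rfl fun j _ => ?_
  rw [Matrix.diagonal_mul, Matrix.diagonal_mul, Matrix.transpose_apply]
  ring

theorem cfc_one_eq {A : Matrix n n ℝ} (hA : A.IsHermitian) : cfc (fun _ : ℝ => (1 : ℝ)) A = 1 :=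
  cfc_const_one ℝ A (ha := hA.isSelfAdjoint)

theorem cfc_id_eq {A : Matrix n n ℝ} (hA : A.IsHermitian) : cfc (fun x : ℝ => x) A = A :=
  cfc_id' ℝ A (ha := hA.isSelfAdjoint)

theorem cfc_mul_eq {A : Matrix n n ℝ} (f g : ℝ → ℝ) :
    cfc f A * cfc g A = cfc (fun x => f x * g x) A :=
  (cfc_mul f g A (by
    rw [continuousOn_iff_continuous_domRestrict]; fun_prop) (by
    rw [continuousOn_iff_continuous_domRestrict]; fun_prop)).symm

end Spectral

/-! ### Relative entropy: integral representation and joint convexity -/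

section RelativeEntropy

/-- An explicit primitive that vanishes at infinity; minus its value at `0` is the scalar relative
entropy of `x` and `y`. -/
theorem hasDerivAt_relEntropy_primitive {x y : ℝ} (hx : 0 < x) (hy : 0 < y) {s : ℝ} (hs : 0 ≤ s) :
    HasDerivAt (fun s => x * Real.log ((1 + s) * y / (x + s * y)) - (y - x) / (1 + s))
      (s / (1 + s) ^ 2 * ((x - y) ^ 2 / (x + s * y))) s := by
  have h1 : 0 < 1 + s := by positivity
  have h2 : 0 < x + s * y := by positivity
  have d1 : HasDerivAt (fun s : ℝ => (1 + s) * y) y s := by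
    simpa using ((hasDerivAt_id s).const_add 1).mul_const y
  have d2 : HasDerivAt (fun s : ℝ => x + s * y) y s := by
    simpa using ((hasDerivAt_id s).mul_const y).const_add x
  have hq : (1 + s) * y / (x + s * y) ≠ 0 := by positivity
  have d3 : HasDerivAt (fun s : ℝ => x * Real.log ((1 + s) * y / (x + s * y)))
      (x * ((y * (x + s * y) - (1 + s) * y * y) / (x + s * y) ^ 2 /
        ((1 + s) * y / (x + s * y)))) s :=
    ((d1.div d2 h2.ne').log hq).const_mul x
  have d4 : HasDerivAt (fun s : ℝ => (y - x) / (1 + s)) (-(y - x) / (1 + s) ^ 2) s :=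
    ((hasDerivAt_const s (y - x)).div ((hasDerivAt_id s).const_add 1) h1.ne').congr_deriv
      (by simp)
  refine (d3.sub d4).congr_deriv ?_
  field_simp
  ring

theorem tendsto_relEntropy_primitive {x y : ℝ} (hx : 0 < x) (hy : 0 < y) :
    Tendsto (fun s => x * Real.log ((1 + s) * y / (x + s * y)) - (y - x) / (1 + s))
      atTop (𝓝 0) := by
  have h1 : Tendsto (fun s : ℝ => (1 + s) * y / (x + s * y)) atTop (𝓝 1) := by
    have h2 : Tendsto (fun s : ℝ => 1 + (y - x) / (x + s * y)) atTop (𝓝 (1 + 0)) := by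
      refine tendsto_const_nhds.add (tendsto_const_nhds.div_atTop ?_)
      exact tendsto_atTop_add_const_left _ _ (tendsto_id.atTop_mul_const hy)
    rw [add_zero] at h2
    refine h2.congr' ?_
    filter_upwards [eventually_ge_atTop 0] with s hs
    have : 0 < x + s * y := by positivity
    field_simp
    ring
  have h3 : Tendsto (fun s : ℝ => (y - x) / (1 + s)) atTop (𝓝 0) :=
    tendsto_const_nhds.div_atTop (tendsto_atTop_add_const_left _ _ tendsto_id)
  have h4 := ((Real.continuousAt_log one_ne_zero).tendsto.comp h1).const_mul x
  simpa using h4.sub h3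

theorem relEntropy_integrand_nonneg {x y : ℝ} (hx : 0 < x) (hy : 0 < y) {s : ℝ} (hs : 0 ≤ s) :
    0 ≤ s / (1 + s) ^ 2 * ((x - y) ^ 2 / (x + s * y)) := by positivity

theorem integrableOn_relEntropy {x y : ℝ} (hx : 0 < x) (hy : 0 < y) :
    IntegrableOn (fun s => s / (1 + s) ^ 2 * ((x - y) ^ 2 / (x + s * y))) (Set.Ioi 0) :=
  integrableOn_Ioi_deriv_of_nonneg'
    (fun _ hs => hasDerivAt_relEntropy_primitive hx hy hs)
    (fun _ hs => relEntropy_integrand_nonneg hx hy (le_of_lt hs))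
    (tendsto_relEntropy_primitive hx hy)

theorem integral_relEntropy {x y : ℝ} (hx : 0 < x) (hy : 0 < y) :
    ∫ s in Set.Ioi (0 : ℝ), s / (1 + s) ^ 2 * ((x - y) ^ 2 / (x + s * y)) =
      x * Real.log x - x * Real.log y - x + y := by
  rw [integral_Ioi_of_hasDerivAt_of_nonneg'
    (fun _ hs => hasDerivAt_relEntropy_primitive hx hy hs)
    (fun _ hs => relEntropy_integrand_nonneg hx hy (le_of_lt hs))
    (tendsto_relEntropy_primitive hx hy)]
  simp only [add_zero, one_mul, zero_mul, div_one, Real.log_div hy.ne' hx.ne']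
  ring

variable {n : Type*} [Fintype n] [DecidableEq n]

/-- The quantum relative entropy of two positive definite matrices. -/
noncomputable def relEntropy (M A : Matrix n n ℝ) : ℝ :=
  (M * CFC.log M).trace - (M * CFC.log A).trace - M.trace + A.trace

/-- The quadratic quantities whose weighted integral is the relative entropy. -/
noncomputable def relQuad (s : ℝ) {M A : Matrix n n ℝ} (hM : M.IsHermitian) (hA : A.IsHermitian) :
    ℝ :=
  ∑ i, ∑ j, eigenCoeff hM hA 1 i j ^ 2 *
    ((hM.eigenvalues i - hA.eigenvalues j) ^ 2 / (hM.eigenvalues i + s * hA.eigenvalues j))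

/-- The functional, linear in `(M, A)`, whose supremum over `Z` is `relQuad s`. -/
noncomputable def relLin (s : ℝ) (Z M A : Matrix n n ℝ) : ℝ :=
  2 * ((M * Zᵀ).trace - (A * Zᵀ).trace) - (M * Z * Zᵀ).trace - s * (Z * A * Zᵀ).trace

omit [DecidableEq n] in
theorem relLin_combo (s a b : ℝ) (Z M₁ M₂ A₁ A₂ : Matrix n n ℝ) :
    relLin s Z (a • M₁ + b • M₂) (a • A₁ + b • A₂) =
      a * relLin s Z M₁ A₁ + b * relLin s Z M₂ A₂ := by
  simp only [relLin, Matrix.add_mul, Matrix.mul_add, Matrix.smul_mul, Matrix.mul_smul,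
    Matrix.trace_add, Matrix.trace_smul, smul_eq_mul]
  ring

theorem relLin_eq_sum (s : ℝ) (Z : Matrix n n ℝ) {M A : Matrix n n ℝ} (hM : M.IsHermitian)
    (hA : A.IsHermitian) :
    relLin s Z M A = ∑ i, ∑ j,
      (2 * (hM.eigenvalues i - hA.eigenvalues j) * eigenCoeff hM hA 1 i j * eigenCoeff hM hA Z i j
        - (hM.eigenvalues i + s * hA.eigenvalues j) * eigenCoeff hM hA Z i j ^ 2) := by
  have h1 := trace_cfc_mul_cfc hM hA (fun x => x) (fun _ => 1) 1 Z
  have h2 := trace_cfc_mul_cfc hM hA (fun _ => 1) (fun x => x) 1 Z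
  have h3 := trace_cfc_mul_cfc hM hA (fun x => x) (fun _ => 1) Z Z
  have h4 := trace_cfc_mul_cfc hM hA (fun _ => 1) (fun x => x) Z Z
  simp only [cfc_one_eq hM, cfc_one_eq hA, cfc_id_eq hM, cfc_id_eq hA, Matrix.mul_one,
    Matrix.one_mul] at h1 h2 h3 h4
  rw [relLin, h1, h2, h3, h4]
  simp only [Finset.mul_sum, ← Finset.sum_sub_distrib]
  refine Finset.sum_congr rfl fun i _ => Finset.sum_congr rfl fun j _ => ?_
  ring

/-- Complete the square in each coefficient of `Z`. -/
theorem relLin_le_relQuad {s : ℝ} (hs : 0 ≤ s) (Z : Matrix n n ℝ) {M A : Matrix n n ℝ}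
    (hM : M.PosDef) (hA : A.PosDef) :
    relLin s Z M A ≤ relQuad s hM.1 hA.1 := by
  rw [relLin_eq_sum s Z hM.1 hA.1, relQuad]
  refine Finset.sum_le_sum fun i _ => Finset.sum_le_sum fun j _ => ?_
  have hx := hM.eigenvalues_pos i
  have hy := hA.eigenvalues_pos j
  set x := hM.1.eigenvalues i
  set y := hA.1.eigenvalues j
  set c := eigenCoeff hM.1 hA.1 1 i j
  set z := eigenCoeff hM.1 hA.1 Z i j
  have hp : 0 < x + s * y := by positivity
  rw [← sub_nonneg]
  have : c ^ 2 * ((x - y) ^ 2 / (x + s * y)) -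
      (2 * (x - y) * c * z - (x + s * y) * z ^ 2) =
      (c * (x - y) - (x + s * y) * z) ^ 2 / (x + s * y) := by
    field_simp
    ring
  rw [this]
  positivity

theorem exists_relLin_eq_relQuad {s : ℝ} (hs : 0 ≤ s) {M A : Matrix n n ℝ}
    (hM : M.PosDef) (hA : A.PosDef) :
    ∃ Z, relLin s Z M A = relQuad s hM.1 hA.1 := by
  -- The coefficients at which every completed square vanishes, rotated back to the standard basis
  -- below.
  let W : Matrix n n ℝ := Matrix.of fun i j => eigenCoeff hM.1 hA.1 1 i j *
    (hM.1.eigenvalues i - hA.1.eigenvalues j) / (hM.1.eigenvalues i + s * hA.1.eigenvalues j)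
  let U := (hM.1.eigenvectorUnitary : Matrix n n ℝ)
  let V := (hA.1.eigenvectorUnitary : Matrix n n ℝ)
  have hW : eigenCoeff hM.1 hA.1 (U * W * Vᵀ) = W := by
    calc Uᵀ * (U * W * Vᵀ) * V = (Uᵀ * U) * W * (Vᵀ * V) := by simp only [Matrix.mul_assoc]
      _ = W := by
        rw [eigenvectorUnitary_transpose_mul, eigenvectorUnitary_transpose_mul, Matrix.one_mul,
          Matrix.mul_one]
  refine ⟨U * W * Vᵀ, ?_⟩
  rw [relLin_eq_sum s _ hM.1 hA.1, relQuad, hW]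
  refine Finset.sum_congr rfl fun i _ => Finset.sum_congr rfl fun j _ => ?_
  have hx := hM.eigenvalues_pos i
  have hy := hA.eigenvalues_pos j
  have hp : 0 < hM.1.eigenvalues i + s * hA.1.eigenvalues j := by positivity
  simp only [W, Matrix.of_apply]
  field_simp
  ring

theorem relEntropy_eq_sum {M A : Matrix n n ℝ} (hM : M.IsHermitian) (hA : A.IsHermitian) :
    relEntropy M A = ∑ i, ∑ j, eigenCoeff hM hA 1 i j ^ 2 *
      (hM.eigenvalues i * Real.log (hM.eigenvalues i) -
        hM.eigenvalues i * Real.log (hA.eigenvalues j) -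
        hM.eigenvalues i + hA.eigenvalues j) := by
  have h1 := trace_cfc_mul_cfc hM hA (fun x => x * Real.log x) (fun _ => 1) 1 1
  have h2 := trace_cfc_mul_cfc hM hA (fun x => x) Real.log 1 1
  have h3 := trace_cfc_mul_cfc hM hA (fun x => x) (fun _ => 1) 1 1
  have h4 := trace_cfc_mul_cfc hM hA (fun _ => 1) (fun x => x) 1 1
  simp only [cfc_one_eq hM, cfc_one_eq hA, cfc_id_eq hM, cfc_id_eq hA, Matrix.mul_one,
    Matrix.one_mul, Matrix.transpose_one] at h1 h2 h3 h4
  have h5 : M * CFC.log M = cfc (fun x => x * Real.log x) M := by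
    rw [← cfc_mul_eq, cfc_id_eq hM, CFC.log]
  rw [relEntropy, h5, h1, CFC.log, h2, h3, h4]
  simp only [← Finset.sum_sub_distrib, ← Finset.sum_add_distrib]
  refine Finset.sum_congr rfl fun i _ => Finset.sum_congr rfl fun j _ => ?_
  ring

/-- Klein's inequality: each scalar relative entropy is the integral of a nonnegative function. -/
theorem relEntropy_nonneg {M A : Matrix n n ℝ} (hM : M.PosDef) (hA : A.PosDef) :
    0 ≤ relEntropy M A := by
  rw [relEntropy_eq_sum hM.1 hA.1]
  refine Finset.sum_nonneg fun i _ => Finset.sum_nonneg fun j _ => mul_nonneg (sq_nonneg _) ?_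
  rw [← integral_relEntropy (hM.eigenvalues_pos i) (hA.eigenvalues_pos j)]
  exact setIntegral_nonneg measurableSet_Ioi fun s hs =>
    relEntropy_integrand_nonneg (hM.eigenvalues_pos i) (hA.eigenvalues_pos j) (le_of_lt hs)

theorem weight_mul_relQuad (s : ℝ) {M A : Matrix n n ℝ} (hM : M.IsHermitian)
    (hA : A.IsHermitian) :
    s / (1 + s) ^ 2 * relQuad s hM hA = ∑ i, ∑ j, eigenCoeff hM hA 1 i j ^ 2 *
      (s / (1 + s) ^ 2 * ((hM.eigenvalues i - hA.eigenvalues j) ^ 2 /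
        (hM.eigenvalues i + s * hA.eigenvalues j))) := by
  rw [relQuad, Finset.mul_sum]
  refine Finset.sum_congr rfl fun i _ => ?_
  rw [Finset.mul_sum]
  exact Finset.sum_congr rfl fun j _ => by ring

theorem integrableOn_relQuad {M A : Matrix n n ℝ} (hM : M.PosDef) (hA : A.PosDef) :
    IntegrableOn (fun s => s / (1 + s) ^ 2 * relQuad s hM.1 hA.1) (Set.Ioi 0) := by
  simp only [weight_mul_relQuad]
  exact integrable_finsetSum _ fun i _ => integrable_finsetSum _ fun j _ =>
    (integrableOn_relEntropy (hM.eigenvalues_pos i) (hA.eigenvalues_pos j)).const_mul _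

theorem integral_relQuad {M A : Matrix n n ℝ} (hM : M.PosDef) (hA : A.PosDef) :
    ∫ s in Set.Ioi (0 : ℝ), s / (1 + s) ^ 2 * relQuad s hM.1 hA.1 = relEntropy M A := by
  have hint := fun i j =>
    (integrableOn_relEntropy (hM.eigenvalues_pos i) (hA.eigenvalues_pos j)).const_mul
      (eigenCoeff hM.1 hA.1 1 i j ^ 2)
  simp only [weight_mul_relQuad]
  rw [integral_finsetSum _ fun i _ => integrable_finsetSum _ fun j _ => hint i j,
    relEntropy_eq_sum hM.1 hA.1]
  refine Finset.sum_congr rfl fun i _ => ?_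
  rw [integral_finsetSum _ fun j _ => hint i j]
  refine Finset.sum_congr rfl fun j _ => ?_
  rw [integral_const_mul, integral_relEntropy (hM.eigenvalues_pos i) (hA.eigenvalues_pos j)]

omit [Fintype n] [DecidableEq n] in
theorem posDef_combo {a b : ℝ} (ha : 0 ≤ a) (hb : 0 ≤ b) (hab : a + b = 1) {A B : Matrix n n ℝ}
    (hA : A.PosDef) (hB : B.PosDef) : (a • A + b • B).PosDef := by
  rcases ha.eq_or_lt with rfl | ha
  · have : b = 1 := by linarith
    subst this
    simpa using hB
  · exact (hA.smul ha).add_posSemidef (hB.posSemidef.smul hb)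

theorem relEntropy_combo_le {a b : ℝ} (ha : 0 ≤ a) (hb : 0 ≤ b) (hab : a + b = 1)
    {M₁ M₂ A₁ A₂ : Matrix n n ℝ} (hM₁ : M₁.PosDef) (hM₂ : M₂.PosDef) (hA₁ : A₁.PosDef)
    (hA₂ : A₂.PosDef) :
    relEntropy (a • M₁ + b • M₂) (a • A₁ + b • A₂) ≤
      a * relEntropy M₁ A₁ + b * relEntropy M₂ A₂ := by
  have hM := posDef_combo ha hb hab hM₁ hM₂
  have hA := posDef_combo ha hb hab hA₁ hA₂
  rw [← integral_relQuad hM hA, ← integral_relQuad hM₁ hA₁, ← integral_relQuad hM₂ hA₂,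
    ← integral_const_mul, ← integral_const_mul,
    ← integral_add ((integrableOn_relQuad hM₁ hA₁).const_mul a)
      ((integrableOn_relQuad hM₂ hA₂).const_mul b)]
  refine setIntegral_mono_on (integrableOn_relQuad hM hA)
    (((integrableOn_relQuad hM₁ hA₁).const_mul a).add
      ((integrableOn_relQuad hM₂ hA₂).const_mul b)) measurableSet_Ioi fun s hs => ?_
  have hs0 : 0 ≤ s := le_of_lt hs
  -- The maximizer for the mixture is only a competitor at the two endpoints, and `relLin` is
  -- linear: a supremum of linear functionals is convex.
  obtain ⟨Z, hZ⟩ := exists_relLin_eq_relQuad hs0 hM hA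
  have h1 := relLin_le_relQuad hs0 Z hM₁ hA₁
  have h2 := relLin_le_relQuad hs0 Z hM₂ hA₂
  rw [← hZ, relLin_combo]
  have hw : 0 ≤ s / (1 + s) ^ 2 := by positivity
  calc s / (1 + s) ^ 2 * (a * relLin s Z M₁ A₁ + b * relLin s Z M₂ A₂)
      ≤ s / (1 + s) ^ 2 * (a * relQuad s hM₁.1 hA₁.1 + b * relQuad s hM₂.1 hA₂.1) := by gcongr
    _ = _ := by ring

end RelativeEntropy

/-! ### Lieb's theorem and monotonicity of the trace exponential -/

section TraceExp

variable {n : Type*} [Fintype n] [DecidableEq n]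

theorem posDef_exp {A : Matrix n n ℝ} (hA : A.IsHermitian) : (NormedSpace.exp A).PosDef := by
  rw [← Matrix.isStrictlyPositive_iff_posDef]
  exact (Matrix.isUnit_exp A).isStrictlyPositive hA.isSelfAdjoint.exp_nonneg

theorem isHermitian_log (A : Matrix n n ℝ) : (CFC.log A).IsHermitian :=
  (IsSelfAdjoint.log (a := A)).isHermitian

theorem relEntropy_exp (M : Matrix n n ℝ) {B : Matrix n n ℝ} (hB : B.IsHermitian) :
    relEntropy M (NormedSpace.exp B) =
      (M * CFC.log M).trace - (M * B).trace - M.trace + (NormedSpace.exp B).trace := by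
  rw [relEntropy, CFC.log_exp B hB.isSelfAdjoint]

/-- **Lieb's theorem**: `A ↦ tr exp (H + log A)` is concave on the positive definite matrices. -/
theorem concaveOn_trace_exp_add_log {H : Matrix n n ℝ} (hH : H.IsHermitian) :
    ConcaveOn ℝ {A : Matrix n n ℝ | A.PosDef}
      (fun A => (NormedSpace.exp (H + CFC.log A)).trace) := by
  refine ⟨fun A hA B hB a b ha hb hab => posDef_combo ha hb hab hA hB,
    fun A₁ hA₁ A₂ hA₂ a b ha hb hab => ?_⟩
  have hl : ∀ A : Matrix n n ℝ, (H + CFC.log A).IsHermitian := fun A => hH.add (isHermitian_log A)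
  have hM₁ := posDef_exp (hl A₁)
  have hM₂ := posDef_exp (hl A₂)
  have hM := posDef_combo ha hb hab hM₁ hM₂
  have h1 := relEntropy_combo_le ha hb hab hM₁ hM₂ hA₁ hA₂
  -- In the variational formula the mixture of the two optimal `M` is a competitor at the mixed `A`;
  -- joint convexity bounds its entropy.
  have h2 := relEntropy_nonneg hM (posDef_exp (hl (a • A₁ + b • A₂)))
  rw [relEntropy_exp _ (hl _)] at h2
  simp only [relEntropy] at h1
  rw [CFC.log_exp _ (hl A₁).isSelfAdjoint, CFC.log_exp _ (hl A₂).isSelfAdjoint] at h1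
  simp only [smul_eq_mul]
  set M₁ := NormedSpace.exp (H + CFC.log A₁)
  set M₂ := NormedSpace.exp (H + CFC.log A₂)
  set M := a • M₁ + b • M₂ with hMdef
  have e1 : M.trace = a * M₁.trace + b * M₂.trace := by
    simp [hMdef, Matrix.trace_add, Matrix.trace_smul]
  have e2 : (M * H).trace = a * (M₁ * H).trace + b * (M₂ * H).trace := by
    simp [hMdef, Matrix.trace_add, Matrix.trace_smul, Matrix.add_mul]
  have e3 : (a • A₁ + b • A₂).trace = a * A₁.trace + b * A₂.trace := by
    simp [Matrix.trace_add, Matrix.trace_smul]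
  simp only [Matrix.mul_add, Matrix.trace_add] at h1 h2
  simp only [Matrix.trace_smul, smul_eq_mul] at h1 e3
  nlinarith [h1, h2, e1, e2, e3]

theorem trace_mul_nonneg {A B : Matrix n n ℝ} (hA : A.PosSemidef) (hB : B.PosSemidef) :
    0 ≤ (A * B).trace := by
  have h := trace_cfc_mul_cfc hA.1 hB.1 (fun x => x) (fun x => x) 1 1
  simp only [cfc_id_eq hA.1, cfc_id_eq hB.1, Matrix.mul_one, Matrix.transpose_one] at h
  rw [h]
  exact Finset.sum_nonneg fun i _ => Finset.sum_nonneg fun j _ =>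
    mul_nonneg (mul_nonneg (hA.eigenvalues_nonneg i) (hB.eigenvalues_nonneg j))
      (mul_self_nonneg _)

/-- The trace exponential is monotone. -/
theorem trace_exp_mono {A B : Matrix n n ℝ} (hA : A.IsHermitian) (hB : B.IsHermitian)
    (hAB : A ≤ B) : (NormedSpace.exp A).trace ≤ (NormedSpace.exp B).trace := by
  -- Klein's inequality here reads `tr e^B ≥ tr e^A + tr (e^A (B - A))`.
  have h := relEntropy_nonneg (posDef_exp hA) (posDef_exp hB)
  rw [relEntropy_exp _ hB, CFC.log_exp _ hA.isSelfAdjoint] at h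
  have h2 : 0 ≤ (NormedSpace.exp A * (B - A)).trace :=
    trace_mul_nonneg (posDef_exp hA).posSemidef (Matrix.le_iff.mp hAB)
  rw [Matrix.mul_sub, Matrix.trace_sub] at h2
  linarith

end TraceExp

/-! ### Scalar inequalities on the unit interval -/

section ScalarHoeffding

theorem one_add_mul_exp_pos {p : ℝ} (hp : p ∈ Set.Icc (0 : ℝ) 1) (θ : ℝ) :
    0 < 1 + (Real.exp θ - 1) * p := by
  have := Real.exp_pos θ
  rcases hp.1.eq_or_lt with h | h
  · rw [← h]; simp
  · nlinarith [mul_pos this h, hp.2]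

/-- The convex function `exp` lies below its chord between `0` and `θ`. -/
theorem mul_le_log_one_add {p : ℝ} (hp : p ∈ Set.Icc (0 : ℝ) 1) (θ : ℝ) :
    θ * p ≤ Real.log (1 + (Real.exp θ - 1) * p) := by
  rw [Real.le_log_iff_exp_le (one_add_mul_exp_pos hp θ)]
  have h := convexOn_exp.2 (Set.mem_univ 0) (Set.mem_univ θ) (sub_nonneg.2 hp.2) hp.1 (by ring)
  simp only [smul_eq_mul, mul_zero, zero_add, Real.exp_zero, mul_one] at h
  rw [mul_comm θ p]
  linarith

/-- Hoeffding's lemma for a Bernoulli variable. -/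
theorem log_one_add_sub_le {p : ℝ} (hp : p ∈ Set.Icc (0 : ℝ) 1) (θ : ℝ) :
    Real.log (1 + (Real.exp θ - 1) * p) - θ * p ≤ θ ^ 2 / 8 := by
  -- The left side is the cumulant generating function of the centered Bernoulli law with parameter
  -- `p`, whose range of length `1` gives the variance proxy `1/4`.
  let μ : Measure ℝ := ENNReal.ofReal (1 - p) • Measure.dirac 0 + ENNReal.ofReal p • Measure.dirac 1
  have hint : ∀ f : ℝ → ℝ, ∫ x, f x ∂μ = (1 - p) * f 0 + p * f 1 := fun f => by
    rw [integral_add_measure (integrable_dirac (by simp) |>.smul_measure (by simp))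
      (integrable_dirac (by simp) |>.smul_measure (by simp))]
    simp [integral_smul_measure, hp.1, hp.2]
  have : IsProbabilityMeasure μ := ⟨by
    simp only [μ, Measure.coe_add, Measure.coe_smul, Pi.add_apply, Pi.smul_apply, measure_univ,
      smul_eq_mul, mul_one]
    rw [← ENNReal.ofReal_add (sub_nonneg.2 hp.2) hp.1]
    simp⟩
  have hb : ∀ᵐ x ∂μ, (fun x : ℝ => x) x ∈ Set.Icc (0 : ℝ) 1 := by
    rw [ae_add_measure_iff]
    constructor
    · exact Measure.ae_smul_measure (by simp [ae_dirac_eq]) _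
    · exact Measure.ae_smul_measure (by simp [ae_dirac_eq]) _
  have h := (hasSubgaussianMGF_of_mem_Icc (X := fun x : ℝ => x) aemeasurable_id hb).mgf_le θ
  rw [mgf, hint, hint] at h
  rw [sub_le_iff_le_add', Real.log_le_iff_le_exp (one_add_mul_exp_pos hp θ), Real.exp_add]
  have e : θ ^ 2 / 8 = ((‖(1 : ℝ) - 0‖₊ / 2) ^ 2 : NNReal) * θ ^ 2 / 2 := by
    simp; ring
  rw [e]
  refine le_trans (le_of_eq ?_) (mul_le_mul_of_nonneg_left h (Real.exp_pos _).le)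
  simp only [mul_zero, mul_one, zero_add, zero_sub]
  rw [mul_add, mul_left_comm, mul_left_comm _ p, ← Real.exp_add, ← Real.exp_add,
    show θ * p + θ * -p = 0 by ring, show θ * p + θ * (1 - p) = θ by ring, Real.exp_zero]
  ring

end ScalarHoeffding

/-! ### Loewner order and functional calculus -/

section Order

variable {n : Type*} [Fintype n] [DecidableEq n]

omit [DecidableEq n] in
theorem isClosed_setOf_le (A : Matrix n n ℝ) : IsClosed {B : Matrix n n ℝ | A ≤ B} := by
  have : {B : Matrix n n ℝ | A ≤ B} = {B | (B - A)ᴴ = B - A} ∩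
      ⋂ x : n → ℝ, {B | 0 ≤ star x ⬝ᵥ ((B - A) *ᵥ x)} := by
    ext B
    simp only [Set.mem_ofPred_eq, Matrix.le_iff, Matrix.posSemidef_iff_dotProduct_mulVec,
      Set.mem_inter_iff, Set.mem_iInter]
    rfl
  rw [this]
  exact (isClosed_eq (by fun_prop) (by fun_prop)).inter
    (isClosed_iInter fun x => isClosed_le (by fun_prop) (by fun_prop))

omit [Fintype n] [DecidableEq n] in
theorem convex_setOf_le (A : Matrix n n ℝ) : Convex ℝ {B : Matrix n n ℝ | A ≤ B} := by
  intro B hB C hC a b ha hb hab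
  have h : a • B + b • C - A = a • (B - A) + b • (C - A) := by
    rw [smul_sub, smul_sub, sub_add_sub_comm, ← add_smul, hab, one_smul]
  rw [Set.mem_ofPred_eq, Matrix.le_iff] at *
  rw [h]
  exact (hB.smul ha).add (hC.smul hb)

theorem spectrum_subset_Icc {A : Matrix n n ℝ} (h0 : 0 ≤ A) (h1 : A ≤ 1) :
    spectrum ℝ A ⊆ Set.Icc 0 1 := fun x hx =>
  ⟨spectrum_nonneg_of_nonneg h0 hx, by
    have := (CFC.le_one_iff (R := ℝ) A
      (ha := (Matrix.nonneg_iff_posSemidef.1 h0).1.isSelfAdjoint)).1 h1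
    exact this x hx⟩

theorem continuousOn_spectrum (f : ℝ → ℝ) (A : Matrix n n ℝ) : ContinuousOn f (spectrum ℝ A) := by
  rw [continuousOn_iff_continuous_domRestrict]; fun_prop

theorem one_add_smul_eq_cfc {A : Matrix n n ℝ} (hA : A.IsHermitian) (c : ℝ) :
    1 + c • A = cfc (fun x => 1 + c * x) A := by
  rw [cfc_add _ _ _ (continuousOn_spectrum _ _) (continuousOn_spectrum _ _), cfc_one_eq hA,
    cfc_const_mul _ _ _ (continuousOn_spectrum _ _), cfc_id_eq hA]

theorem log_one_add_smul {A : Matrix n n ℝ} (hA : A.IsHermitian) (c : ℝ)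
    (hc : ∀ x ∈ spectrum ℝ A, 1 + c * x ≠ 0) :
    CFC.log (1 + c • A) = cfc (fun x => Real.log (1 + c * x)) A := by
  rw [one_add_smul_eq_cfc hA, CFC.log, ← cfc_comp' Real.log _ A ?_ (continuousOn_spectrum _ _)
    hA.isSelfAdjoint]
  exact Real.continuousOn_log.mono fun y ⟨x, hx, hy⟩ => by simpa [← hy] using hc x hx

theorem smul_eq_cfc {A : Matrix n n ℝ} (hA : A.IsHermitian) (c : ℝ) :
    c • A = cfc (fun x => c * x) A := by
  rw [cfc_const_mul _ _ _ (continuousOn_spectrum _ _), cfc_id_eq hA]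

theorem smul_le_log_one_add_smul {A : Matrix n n ℝ} (h0 : 0 ≤ A) (h1 : A ≤ 1) (θ : ℝ) :
    θ • A ≤ CFC.log (1 + (Real.exp θ - 1) • A) := by
  have hA := (Matrix.nonneg_iff_posSemidef.1 h0).1
  have hs := spectrum_subset_Icc h0 h1
  rw [log_one_add_smul hA _ fun x hx => (one_add_mul_exp_pos (hs hx) θ).ne', smul_eq_cfc hA]
  exact cfc_mono (fun x hx => mul_le_log_one_add (hs hx) θ) (continuousOn_spectrum _ _)
    (continuousOn_spectrum _ _)

theorem log_one_add_smul_sub_le {A : Matrix n n ℝ} (h0 : 0 ≤ A) (h1 : A ≤ 1) (θ : ℝ) :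
    CFC.log (1 + (Real.exp θ - 1) • A) - θ • A ≤ (θ ^ 2 / 8) • 1 := by
  have hA := (Matrix.nonneg_iff_posSemidef.1 h0).1
  have hs := spectrum_subset_Icc h0 h1
  rw [log_one_add_smul hA _ fun x hx => (one_add_mul_exp_pos (hs hx) θ).ne', smul_eq_cfc hA,
    ← cfc_sub _ _ _ (continuousOn_spectrum _ _) (continuousOn_spectrum _ _),
    ← Algebra.algebraMap_eq_smul_one]
  exact cfc_le_algebraMap _ _ _ (fun x hx => log_one_add_sub_le (hs hx) θ)
    (continuousOn_spectrum _ _) hA.isSelfAdjoint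

omit [Fintype n] in
theorem posDef_of_smul_one_le {A : Matrix n n ℝ} {c : ℝ} (hc : 0 < c) (h : c • 1 ≤ A) :
    A.PosDef := by
  have := (Matrix.PosDef.one.smul hc).add_posSemidef (Matrix.le_iff.1 h)
  simpa using this

/-- Jensen needs a closed convex domain, and the positive definite cone is not closed; a uniform
positive lower bound supplies a closed subset of it. -/
theorem smul_one_le_one_add_smul {A : Matrix n n ℝ} (h0 : 0 ≤ A) (h1 : A ≤ 1) (θ : ℝ) :
    min 1 (Real.exp θ) • (1 : Matrix n n ℝ) ≤ 1 + (Real.exp θ - 1) • A := by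
  have hA := (Matrix.nonneg_iff_posSemidef.1 h0).1
  have hs := spectrum_subset_Icc h0 h1
  rw [one_add_smul_eq_cfc hA, ← Algebra.algebraMap_eq_smul_one]
  refine algebraMap_le_cfc _ _ _ (fun x hx => ?_) (continuousOn_spectrum _ _) hA.isSelfAdjoint
  obtain ⟨hx0, hx1⟩ := hs hx
  rcases le_total 1 (Real.exp θ) with h | h
  · rw [min_eq_left h]; nlinarith
  · rw [min_eq_right h]; nlinarith

theorem continuous_exp_matrix : Continuous (NormedSpace.exp : Matrix n n ℝ → Matrix n n ℝ) :=
  letI : NormedAlgebra ℚ (Matrix n n ℝ) := NormedAlgebra.restrictScalars ℚ ℝ _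
  NormedSpace.exp_continuous

theorem continuousOn_trace_exp_add_log (H : Matrix n n ℝ) :
    ContinuousOn (fun A => (NormedSpace.exp (H + CFC.log A)).trace)
      {A : Matrix n n ℝ | A.PosDef} := by
  have h1 : ContinuousOn (CFC.log : Matrix n n ℝ → Matrix n n ℝ) {A | A.PosDef} :=
    CFC.continuousOn_log.mono fun A hA => ⟨hA.1.isSelfAdjoint, hA.isUnit⟩
  have h2 : Continuous fun A : Matrix n n ℝ => (NormedSpace.exp (H + A)).trace :=
    (continuous_exp_matrix.comp (continuous_const.add continuous_id)).matrix_trace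
  exact h2.comp_continuousOn h1

end Order

/-! ### Matrix Laplace transform of an i.i.d. sum -/

section Laplace

variable {n : Type*} [Fintype n] [DecidableEq n]
  {α : Type*} [TopologicalSpace α] [CompactSpace α] [SecondCountableTopology α]
  [MeasurableSpace α] [BorelSpace α]

-- Compactness of the sample space makes integrability automatic; for this reason the watermark is
-- later transported to the closed unit ball.
omit [SecondCountableTopology α] in
theorem integrable_of_continuous {E : Type*} [NormedAddCommGroup E] {f : α → E}
    (hf : Continuous f) (μ : Measure α) [IsFiniteMeasure μ] : Integrable f μ :=
  hf.integrable_of_hasCompactSupport (HasCompactSupport.of_compactSpace f)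

omit [SecondCountableTopology α] in
theorem integral_mem_unitInterval (μ : Measure α) [IsProbabilityMeasure μ]
    {Y : α → Matrix n n ℝ} (hY : Continuous Y) (h0 : ∀ x, 0 ≤ Y x) (h1 : ∀ x, Y x ≤ 1) :
    0 ≤ ∫ x, Y x ∂μ ∧ ∫ x, Y x ∂μ ≤ 1 := by
  have hi := integrable_of_continuous hY μ
  refine ⟨(convex_setOf_le 0).integral_mem (isClosed_setOf_le 0) (.of_forall h0) hi, ?_⟩
  have h := (convex_setOf_le (0 : Matrix n n ℝ)).integral_mem (isClosed_setOf_le 0)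
    (.of_forall fun x => sub_nonneg.2 (h1 x)) ((integrable_const 1).sub hi)
  rw [integral_sub (integrable_const 1) hi] at h
  simpa using h

-- Replacing `θY` by the larger `log(1 + (e^θ - 1)Y)` makes the argument of the logarithm affine in
-- `Y`, so Jensen for Lieb's concave function moves the mean inside.
omit [SecondCountableTopology α] in
theorem integral_trace_exp_add_le (μ : Measure α) [IsProbabilityMeasure μ]
    {Y : α → Matrix n n ℝ} (hY : Continuous Y) (h0 : ∀ x, 0 ≤ Y x) (h1 : ∀ x, Y x ≤ 1)
    {H : Matrix n n ℝ} (hH : H.IsHermitian) (θ : ℝ) :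
    ∫ x, (NormedSpace.exp (H + θ • Y x)).trace ∂μ ≤
      (NormedSpace.exp (H + CFC.log (1 + (Real.exp θ - 1) • ∫ x, Y x ∂μ))).trace := by
  set c := min 1 (Real.exp θ)
  have hc : 0 < c := lt_min one_pos (Real.exp_pos θ)
  set B : α → Matrix n n ℝ := fun x => 1 + (Real.exp θ - 1) • Y x with hB
  have hBc : Continuous B := by fun_prop
  have hBs : ∀ x, B x ∈ {A : Matrix n n ℝ | c • 1 ≤ A} := fun x =>
    smul_one_le_one_add_smul (h0 x) (h1 x) θ
  have hsub : {A : Matrix n n ℝ | c • 1 ≤ A} ⊆ {A | A.PosDef} := fun A hA =>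
    posDef_of_smul_one_le hc hA
  have hg := (continuousOn_trace_exp_add_log H).mono hsub
  have hgB : Continuous fun x => (NormedSpace.exp (H + CFC.log (B x))).trace :=
    hg.comp_continuous hBc hBs
  have hYc : Continuous fun x => (NormedSpace.exp (H + θ • Y x)).trace :=
    (continuous_exp_matrix.comp (by fun_prop)).matrix_trace
  have hmean : ∫ x, B x ∂μ = 1 + (Real.exp θ - 1) • ∫ x, Y x ∂μ := by
    have hYi : Integrable (fun x => (Real.exp θ - 1) • Y x) μ :=
      integrable_of_continuous (by fun_prop) μ
    simp only [hB]
    rw [integral_add (integrable_const _) hYi, integral_smul]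
    simp
  rw [← hmean]
  refine le_trans (integral_mono (integrable_of_continuous hYc μ)
    (integrable_of_continuous hgB μ) fun x => ?_)
    (((concaveOn_trace_exp_add_log hH).subset hsub (convex_setOf_le _)).le_map_integral hg
      (isClosed_setOf_le _) (.of_forall hBs) (integrable_of_continuous hBc μ)
      (integrable_of_continuous hgB μ))
  have hYH : (Y x).IsHermitian := (Matrix.nonneg_iff_posSemidef.1 (h0 x)).1
  refine trace_exp_mono (hH.add (hYH.smul (IsSelfAdjoint.all θ))) (hH.add (isHermitian_log _)) ?_
  exact add_le_add_right (smul_le_log_one_add_smul (h0 x) (h1 x) θ) H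

/-- Subadditivity of the matrix cumulant generating function. -/
theorem integral_trace_exp_add_sum_le (μ : Measure α) [IsProbabilityMeasure μ]
    {Y : α → Matrix n n ℝ} (hY : Continuous Y) (h0 : ∀ x, 0 ≤ Y x) (h1 : ∀ x, Y x ≤ 1)
    (θ : ℝ) (N : ℕ) {H : Matrix n n ℝ} (hH : H.IsHermitian) :
    ∫ x : Fin N → α, (NormedSpace.exp (H + θ • ∑ i, Y (x i))).trace ∂(Measure.pi fun _ => μ) ≤
      (NormedSpace.exp (H + (N : ℝ) • CFC.log (1 + (Real.exp θ - 1) • ∫ x, Y x ∂μ))).trace := by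
  set Λ := CFC.log (1 + (Real.exp θ - 1) • ∫ x, Y x ∂μ)
  have hΛ : Λ.IsHermitian := isHermitian_log _
  have hYH : ∀ x, (Y x).IsHermitian := fun x => (Matrix.nonneg_iff_posSemidef.1 (h0 x)).1
  -- Each integrated variable leaves a deterministic term `Λ`, which is absorbed into `H`.
  induction N generalizing H with
  | zero => simp
  | succ N ih =>
    have e := (measurePreserving_piFinSuccAbove (fun _ : Fin (N + 1) => μ) 0).integral_comp'
      (fun z : α × (Fin N → α) =>
        (NormedSpace.exp (H + θ • ∑ i, Y (z.2 i) + θ • Y z.1)).trace)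
    have hc : Continuous fun z : α × (Fin N → α) =>
        (NormedSpace.exp (H + θ • ∑ i, Y (z.2 i) + θ • Y z.1)).trace :=
      (continuous_exp_matrix.comp (by fun_prop)).matrix_trace
    have hc' : Continuous fun y : Fin N → α =>
        (NormedSpace.exp (H + Λ + θ • ∑ i, Y (y i))).trace :=
      (continuous_exp_matrix.comp (by fun_prop)).matrix_trace
    have hi := integrable_of_continuous hc (μ.prod (Measure.pi fun _ : Fin N => μ))
    calc _ = ∫ z : α × (Fin N → α),
          (NormedSpace.exp (H + θ • ∑ i, Y (z.2 i) + θ • Y z.1)).trace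
            ∂(μ.prod (Measure.pi fun _ => μ)) := by
          refine Eq.trans (integral_congr_ae (.of_forall fun x => ?_)) e
          change (NormedSpace.exp (H + θ • ∑ i, Y (x i))).trace = (NormedSpace.exp
            (H + θ • ∑ i : Fin N, Y (x i.succ) + θ • Y (x 0))).trace
          rw [Fin.sum_univ_succ, smul_add, add_assoc, add_comm (θ • Y (x 0))]
      _ = ∫ y : Fin N → α, ∫ x, (NormedSpace.exp (H + θ • ∑ i, Y (y i) + θ • Y x)).trace ∂μ
            ∂(Measure.pi fun _ => μ) := integral_prod_symm _ hi
      _ ≤ ∫ y : Fin N → α, (NormedSpace.exp (H + Λ + θ • ∑ i, Y (y i))).trace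
            ∂(Measure.pi fun _ => μ) := by
          refine integral_mono hi.integral_prod_right
            (integrable_of_continuous hc' _) fun y => ?_
          have := integral_trace_exp_add_le μ hY h0 h1 (H := H + θ • ∑ i, Y (y i))
            (hH.add (Matrix.IsHermitian.smul (isSelfAdjoint_sum _ fun i _ => hYH _)
              (IsSelfAdjoint.all θ))) θ
          rwa [add_right_comm] at this
      _ ≤ _ := ih (hH.add hΛ)
      _ = _ := by rw [add_assoc, Nat.cast_succ, add_smul, one_smul, add_comm Λ]

end Laplace

/-! ### Tail bound for the spectral norm -/

section Tail

variable {n : Type*} [Fintype n] [DecidableEq n]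

theorem trace_exp_smul_one (c : ℝ) :
    (NormedSpace.exp (c • (1 : Matrix n n ℝ))).trace = Fintype.card n * Real.exp c := by
  have h : (c • (1 : Matrix n n ℝ)).IsHermitian :=
    Matrix.isHermitian_one.smul (IsSelfAdjoint.all c)
  rw [← CFC.real_exp_eq_normedSpace_exp h.isSelfAdjoint, ← Algebra.algebraMap_eq_smul_one,
    cfc_algebraMap, Algebra.algebraMap_eq_smul_one]
  simp [Matrix.trace_smul, mul_comm]

theorem exp_mul_eigenvalue_le_trace_exp {A : Matrix n n ℝ} (hA : A.IsHermitian) (θ : ℝ) (i : n) :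
    Real.exp (θ * hA.eigenvalues i) ≤ (NormedSpace.exp (θ • A)).trace := by
  have h : (θ • A).IsHermitian := hA.smul (IsSelfAdjoint.all θ)
  rw [← CFC.real_exp_eq_normedSpace_exp h.isSelfAdjoint, smul_eq_cfc hA,
    ← cfc_comp' Real.exp _ A (Real.continuous_exp.continuousOn) (continuousOn_spectrum _ _)
      hA.isSelfAdjoint, cfc_eq_conj_diagonal hA,
    Matrix.trace_mul_comm, ← Matrix.mul_assoc, eigenvectorUnitary_transpose_mul, Matrix.one_mul,
    Matrix.trace_diagonal]
  exact Finset.single_le_sum (f := fun i => Real.exp (θ * hA.eigenvalues i))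
    (fun j _ => (Real.exp_pos _).le) (Finset.mem_univ i)

theorem trace_exp_nonneg {A : Matrix n n ℝ} (hA : A.IsHermitian) :
    0 ≤ (NormedSpace.exp A).trace :=
  (posDef_exp hA).posSemidef.trace_nonneg

/-- The norm is the largest absolute eigenvalue; one trace handles each sign, whence the factor `2`
in the tail bound. -/
theorem exp_mul_le_trace_exp_add {A : Matrix n n ℝ} (hA : A.IsHermitian) {θ s : ℝ} (hθ : 0 ≤ θ)
    (hs : 0 < s) (hsA : s ≤ ‖A‖) :
    Real.exp (θ * s) ≤ (NormedSpace.exp (θ • A)).trace + (NormedSpace.exp (-θ • A)).trace := by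
  obtain ⟨i, hi⟩ : ∃ i, s ≤ |hA.eigenvalues i| := by
    by_contra! h
    have h2 : ‖cfc (fun x : ℝ => x) A‖ < s := norm_cfc_lt hs fun x hx => by
      rw [hA.spectrum_real_eq_range_eigenvalues] at hx
      obtain ⟨i, rfl⟩ := hx
      exact h i
    rw [cfc_id_eq hA] at h2
    exact absurd hsA (not_le.2 h2)
  have n1 := trace_exp_nonneg (hA.smul (IsSelfAdjoint.all θ))
  have n2 := trace_exp_nonneg (hA.smul (IsSelfAdjoint.all (-θ)))
  rcases le_abs.1 hi with h | h
  · have := exp_mul_eigenvalue_le_trace_exp hA θ i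
    have h3 : Real.exp (θ * s) ≤ Real.exp (θ * hA.eigenvalues i) := by gcongr
    linarith
  · have := exp_mul_eigenvalue_le_trace_exp hA (-θ) i
    have h3 : Real.exp (θ * s) ≤ Real.exp (-θ * hA.eigenvalues i) := by
      apply Real.exp_le_exp.2
      nlinarith
    linarith

variable {α : Type*} [TopologicalSpace α] [CompactSpace α] [SecondCountableTopology α]
  [MeasurableSpace α] [BorelSpace α]

theorem integral_trace_exp_smul_sum_sub_le (μ : Measure α) [IsProbabilityMeasure μ]
    {Y : α → Matrix n n ℝ} (hY : Continuous Y) (h0 : ∀ x, 0 ≤ Y x) (h1 : ∀ x, Y x ≤ 1)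
    (θ : ℝ) (N : ℕ) :
    ∫ x : Fin N → α, (NormedSpace.exp (θ • ∑ i, (Y (x i) - ∫ y, Y y ∂μ))).trace
      ∂(Measure.pi fun _ => μ) ≤ Fintype.card n * Real.exp (N * (θ ^ 2 / 8)) := by
  obtain ⟨hm0, hm1⟩ := integral_mem_unitInterval μ hY h0 h1
  set m := ∫ y, Y y ∂μ
  have hm : m.IsHermitian := (Matrix.nonneg_iff_posSemidef.1 hm0).1
  -- The centering `-Nθm` is deterministic, so it plays the role of `H`.
  have hH : (-((N : ℝ) * θ) • m).IsHermitian := hm.smul (IsSelfAdjoint.all _)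
  have h := integral_trace_exp_add_sum_le μ hY h0 h1 θ N hH
  have e : ∀ x : Fin N → α, θ • ∑ i, (Y (x i) - m) =
      -((N : ℝ) * θ) • m + θ • ∑ i, Y (x i) := fun x => by
    rw [Finset.sum_sub_distrib, Finset.sum_const, Finset.card_univ, Fintype.card_fin,
      ← Nat.cast_smul_eq_nsmul ℝ N m]
    module
  simp only [e]
  refine h.trans ?_
  rw [← trace_exp_smul_one]
  refine trace_exp_mono (hH.add ((isHermitian_log _).smul (IsSelfAdjoint.all _)))
    (Matrix.isHermitian_one.smul (IsSelfAdjoint.all _)) ?_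
  have h2 := log_one_add_smul_sub_le hm0 hm1 θ
  rw [Matrix.le_iff] at h2 ⊢
  have h3 := h2.smul (Nat.cast_nonneg' N : (0 : ℝ) ≤ N)
  convert h3 using 1
  module

/-- **Matrix Hoeffding inequality** for i.i.d. symmetric matrices between `0` and `1`. -/
theorem measureReal_norm_sum_sub_integral_ge_le (μ : Measure α) [IsProbabilityMeasure μ]
    {Y : α → Matrix n n ℝ} (hY : Continuous Y) (h0 : ∀ x, 0 ≤ Y x) (h1 : ∀ x, Y x ≤ 1)
    {N : ℕ} (hN : 1 ≤ N) {s : ℝ} (hs : 0 < s) :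
    (Measure.pi fun _ : Fin N => μ).real {x | s ≤ ‖∑ i, (Y (x i) - ∫ y, Y y ∂μ)‖} ≤
      2 * Fintype.card n * Real.exp (-2 * s ^ 2 / N) := by
  have hN0 : (0 : ℝ) < N := by exact_mod_cast hN
  set m := ∫ y, Y y ∂μ with hmdef
  set ν := Measure.pi fun _ : Fin N => μ
  set S : (Fin N → α) → Matrix n n ℝ := fun x => ∑ i, (Y (x i) - m) with hS
  have hSc : Continuous S := by fun_prop
  have hSH : ∀ x, (S x).IsHermitian := fun x => isSelfAdjoint_sum _ fun i _ =>
    (Matrix.nonneg_iff_posSemidef.1 (h0 _)).1.sub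
      (Matrix.nonneg_iff_posSemidef.1 (integral_mem_unitInterval μ hY h0 h1).1).1
  have hT : ∀ θ : ℝ, Continuous fun x => (NormedSpace.exp (θ • S x)).trace := fun θ =>
    (continuous_exp_matrix.comp (by fun_prop)).matrix_trace
  -- The minimizer of `Nθ²/8 - θs`, with minimum `-2s²/N`.
  set θ := 4 * s / N with hθ
  have hθ0 : 0 ≤ θ := by positivity
  have i1 := integrable_of_continuous (hT θ) ν
  have i2 := integrable_of_continuous (hT (-θ)) ν
  have b1 := integral_trace_exp_smul_sum_sub_le μ hY h0 h1 θ N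
  have b2 := integral_trace_exp_smul_sum_sub_le μ hY h0 h1 (-θ) N
  rw [neg_sq] at b2
  have hM := mul_meas_ge_le_integral_of_nonneg (μ := ν)
    (f := fun x => (NormedSpace.exp (θ • S x)).trace + (NormedSpace.exp (-θ • S x)).trace)
    (.of_forall fun x => add_nonneg (trace_exp_nonneg ((hSH x).smul (IsSelfAdjoint.all θ)))
      (trace_exp_nonneg ((hSH x).smul (IsSelfAdjoint.all (-θ))))) (i1.add i2) (Real.exp (θ * s))
  rw [integral_add i1 i2] at hM
  have hsub : ν.real {x | s ≤ ‖S x‖} ≤ ν.real {x | Real.exp (θ * s) ≤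
      (NormedSpace.exp (θ • S x)).trace + (NormedSpace.exp (-θ • S x)).trace} :=
    measureReal_mono fun x hx => exp_mul_le_trace_exp_add (hSH x) hθ0 hs hx
  have hE := Real.exp_pos (θ * s)
  have key : Real.exp (θ * s) * ν.real {x | s ≤ ‖S x‖} ≤
      2 * Fintype.card n * Real.exp (N * (θ ^ 2 / 8)) :=
    (mul_le_mul_of_nonneg_left hsub hE.le).trans (hM.trans (by linarith))
  have e1 : Real.exp (N * (θ ^ 2 / 8)) = Real.exp (θ * s) * Real.exp (-2 * s ^ 2 / N) := by
    rw [← Real.exp_add]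
    congr 1
    rw [hθ]
    field_simp
    ring
  rw [e1, mul_left_comm] at key
  exact le_of_mul_le_mul_left key hE

end Tail

end MatrixConcentration

namespace DynamicWatermark

open MatrixConcentration
open scoped MatrixOrder

/-! ### Rank-one matrices -/

section Outer

variable {q : ℕ}

theorem outer_apply (v : EuclideanSpace ℝ (Fin q)) (i j : Fin q) : outer v i j = v i * v j := rfl

theorem outer_smul (c : ℝ) (v : EuclideanSpace ℝ (Fin q)) :
    outer (c • v) = c ^ 2 • outer v := by
  ext i j
  simp only [outer_apply, PiLp.smul_apply, Matrix.smul_apply, smul_eq_mul]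
  ring

theorem continuous_outer : Continuous (outer : EuclideanSpace ℝ (Fin q) → _) :=
  continuous_matrix fun i j => by
    simp only [outer_apply]
    fun_prop

theorem isHermitian_outer (v : EuclideanSpace ℝ (Fin q)) : (outer v).IsHermitian := by
  ext i j
  simp [outer_apply, mul_comm]

theorem dotProduct_outer_mulVec (v : EuclideanSpace ℝ (Fin q)) (x : Fin q → ℝ) :
    x ⬝ᵥ (outer v *ᵥ x) = (∑ i, v i * x i) ^ 2 := by
  rw [sq, Finset.sum_mul_sum]
  simp only [dotProduct, Matrix.mulVec, outer_apply, Finset.mul_sum]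
  exact Finset.sum_congr rfl fun i _ => Finset.sum_congr rfl fun j _ => by ring

theorem outer_nonneg (v : EuclideanSpace ℝ (Fin q)) : 0 ≤ outer v := by
  rw [Matrix.nonneg_iff_posSemidef, Matrix.posSemidef_iff_dotProduct_mulVec]
  refine ⟨isHermitian_outer v, fun x => ?_⟩
  rw [star_trivial, dotProduct_outer_mulVec]
  positivity

theorem outer_le_one {v : EuclideanSpace ℝ (Fin q)} (hv : ‖v‖ ≤ 1) : outer v ≤ 1 := by
  rw [Matrix.le_iff, Matrix.posSemidef_iff_dotProduct_mulVec]
  refine ⟨Matrix.isHermitian_one.sub (isHermitian_outer v), fun x => ?_⟩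
  rw [star_trivial, Matrix.sub_mulVec, dotProduct_sub, dotProduct_outer_mulVec,
    Matrix.one_mulVec, sub_nonneg]
  have h1 := Finset.sum_mul_sq_le_sq_mul_sq Finset.univ (fun i => v i) x
  have h2 : ∑ i, v i ^ 2 ≤ 1 := by
    rw [← EuclideanSpace.real_norm_sq_eq]
    nlinarith [norm_nonneg v]
  have h3 : 0 ≤ ∑ i, x i ^ 2 := Finset.sum_nonneg fun i _ => sq_nonneg _
  calc _ ≤ (∑ i, v i ^ 2) * ∑ i, x i ^ 2 := h1
    _ ≤ 1 * ∑ i, x i ^ 2 := by gcongr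
    _ = x ⬝ᵥ x := by simp [dotProduct, sq]

theorem trace_outer (v : EuclideanSpace ℝ (Fin q)) : (outer v).trace = ‖v‖ ^ 2 := by
  rw [EuclideanSpace.real_norm_sq_eq, Matrix.trace]
  exact Finset.sum_congr rfl fun i _ => by simp [outer_apply, sq]

theorem outer_sq (v : EuclideanSpace ℝ (Fin q)) : outer v ^ 2 = ‖v‖ ^ 2 • outer v := by
  ext i j
  rw [sq, Matrix.mul_apply, EuclideanSpace.real_norm_sq_eq, Matrix.smul_apply, smul_eq_mul,
    Finset.sum_mul]
  exact Finset.sum_congr rfl fun k _ => by simp only [outer_apply]; ring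

theorem abs_diag_le_norm (A : Matrix (Fin q) (Fin q) ℝ) (i : Fin q) : |A i i| ≤ ‖A‖ := by
  have h := Matrix.l2_opNorm_mulVec A (EuclideanSpace.single i 1)
  rw [PiLp.norm_single, norm_one, mul_one] at h
  refine le_trans ?_ h
  refine le_trans (le_of_eq ?_) (PiLp.norm_apply_le _ i)
  simp [Real.norm_eq_abs]

theorem trace_le_norm (A : Matrix (Fin q) (Fin q) ℝ) : A.trace ≤ q * ‖A‖ := by
  calc A.trace ≤ ∑ _i : Fin q, ‖A‖ :=
        Finset.sum_le_sum fun i _ => (le_abs_self _).trans (abs_diag_le_norm A i)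
    _ = q * ‖A‖ := by simp

end Outer

/-! ### The watermark: lower bound on `c3` and reduction to the unit ball -/

section Watermark

variable {Ω : Type*} [MeasurableSpace Ω] {P : Measure Ω} [IsProbabilityMeasure P] {q : ℕ}

theorem integral_entry_eq_zero {X : Ω → EuclideanSpace ℝ (Fin q)} {K : ℝ} (hm : Measurable X)
    (hb : ∀ᵐ ω ∂P, ‖X ω‖ ≤ K) (h0 : ∫ ω, X ω ∂P = 0) (i : Fin q) : ∫ ω, X ω i ∂P = 0 := by
  have hi : Integrable X P := Integrable.of_bound hm.aestronglyMeasurable K hb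
  have h := (EuclideanSpace.proj (𝕜 := ℝ) i).integral_comp_comm hi
  rw [h0, map_zero] at h
  exact h

theorem covMatrix_apply {X : Ω → EuclideanSpace ℝ (Fin q)} {K : ℝ} (hm : Measurable X)
    (hb : ∀ᵐ ω ∂P, ‖X ω‖ ≤ K) (h0 : ∫ ω, X ω ∂P = 0) (i j : Fin q) :
    covMatrix P X i j = ∫ ω, outer (X ω) i j ∂P := by
  simp only [covMatrix, Matrix.of_apply, covariance, integral_entry_eq_zero hm hb h0, sub_zero,
    outer_apply]

theorem integrable_norm_pow {X : Ω → EuclideanSpace ℝ (Fin q)} {K : ℝ} (hm : Measurable X)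
    (hb : ∀ᵐ ω ∂P, ‖X ω‖ ≤ K) (k : ℕ) : Integrable (fun ω => ‖X ω‖ ^ k) P := by
  refine Integrable.of_bound (hm.norm.pow_const k).aestronglyMeasurable (K ^ k) ?_
  filter_upwards [hb] with ω h
  rw [Real.norm_of_nonneg (by positivity)]
  gcongr

theorem integrable_outer_apply {X : Ω → EuclideanSpace ℝ (Fin q)} {K : ℝ} (hm : Measurable X)
    (hb : ∀ᵐ ω ∂P, ‖X ω‖ ≤ K) (k : ℕ) (i j : Fin q) :
    Integrable (fun ω => ‖X ω‖ ^ k * outer (X ω) i j) P := by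
  have hc : ∀ l, Measurable fun ω => X ω l := fun l =>
    (EuclideanSpace.proj (𝕜 := ℝ) l).measurable.comp hm
  refine Integrable.mono' (integrable_norm_pow hm hb (k + 2))
    ((hm.norm.pow_const k).mul ((hc i).mul (hc j))).aestronglyMeasurable (.of_forall fun ω => ?_)
  rw [norm_mul, norm_pow, norm_norm, outer_apply, norm_mul, pow_add, sq]
  gcongr
  · exact PiLp.norm_apply_le _ _
  · exact PiLp.norm_apply_le _ _

theorem trace_covMatrix {X : Ω → EuclideanSpace ℝ (Fin q)} {K : ℝ} (hm : Measurable X)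
    (hb : ∀ᵐ ω ∂P, ‖X ω‖ ≤ K) (h0 : ∫ ω, X ω ∂P = 0) :
    (covMatrix P X).trace = ∫ ω, ‖X ω‖ ^ 2 ∂P := by
  simp only [← trace_outer, Matrix.trace, Matrix.diag_apply, covMatrix_apply hm hb h0]
  rw [integral_finsetSum]
  intro i _
  simpa using integrable_outer_apply hm hb 0 i i

theorem trace_matrixExp_outer_sq {X : Ω → EuclideanSpace ℝ (Fin q)} {K : ℝ} (hm : Measurable X)
    (hb : ∀ᵐ ω ∂P, ‖X ω‖ ≤ K) :
    (matrixExp P fun ω => outer (X ω) ^ 2).trace = ∫ ω, ‖X ω‖ ^ 4 ∂P := by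
  have e : ∀ ω, ‖X ω‖ ^ 4 = ∑ i, ‖X ω‖ ^ 2 * outer (X ω) i i := fun ω => by
    rw [← Finset.mul_sum]
    change _ = ‖X ω‖ ^ 2 * (outer (X ω)).trace
    rw [trace_outer]
    ring
  simp only [e, Matrix.trace, Matrix.diag_apply, matrixExp, Matrix.of_apply, outer_sq,
    Matrix.smul_apply, smul_eq_mul]
  rw [integral_finsetSum]
  intro i _
  exact integrable_outer_apply hm hb 2 i i

omit [IsProbabilityMeasure P] in
theorem matrixExp_outer_sq_eq {X X' : Ω → EuclideanSpace ℝ (Fin q)} (h : IdentDistrib X X' P P) :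
    (matrixExp P fun ω => outer (X ω) ^ 2) = matrixExp P fun ω => outer (X' ω) ^ 2 := by
  ext i j
  have hc : Continuous fun v : EuclideanSpace ℝ (Fin q) => (outer v ^ 2) i j :=
    (continuous_outer.pow 2).matrix_elem i j
  exact (h.comp hc.measurable).integral_eq

/-- All summands equal one matrix `B`, with `tr B = (q - 1) Ke⁴ + 𝔼(Ke² - ‖e‖²)²`. Since `tr B ≤
q‖B‖` and `q - 1 ≥ q/2`, the norm of `B` is at least `Ke⁴/2`. -/
theorem c3_lower_bound (hq : 2 ≤ q) {e : ℤ → Ω → EuclideanSpace ℝ (Fin q)} {Ke : ℝ}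
    (hmeas : Measurable (e 0)) (hident : ∀ n, IdentDistrib (e n) (e 0) P P)
    (hbound : ∀ᵐ ω ∂P, ‖e 0 ω‖ ≤ Ke) (hmean : ∫ ω, e 0 ω ∂P = 0) (N : ℕ) :
    N * (Ke ^ 4 / 2) ≤ c3 P e Ke N := by
  set C := covMatrix P (e 0) with hC
  set M := matrixExp P fun ω => outer (e 0 ω) ^ 2 with hM
  set B := (Ke ^ 2 • (1 : Matrix (Fin q) (Fin q) ℝ) - C) ^ 2 + M - C ^ 2 with hB
  have h1 : c3 P e Ke N = N * ‖B‖ := by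
    simp only [c3, fun k : ℕ => matrixExp_outer_sq_eq (hident k)]
    rw [Finset.sum_const, Finset.card_range, ← Nat.cast_smul_eq_nsmul ℝ, norm_smul,
      Real.norm_natCast]
  have h2 : B = Ke ^ 4 • (1 : Matrix (Fin q) (Fin q) ℝ) - (2 * Ke ^ 2) • C + M := by
    simp only [hB, sq, sub_mul, mul_sub, Matrix.smul_mul, Matrix.mul_smul, Matrix.one_mul,
      Matrix.mul_one]
    module
  have i2 := integrable_norm_pow hmeas hbound 2
  have i4 := integrable_norm_pow hmeas hbound 4
  have h3 : B.trace = q * Ke ^ 4 - 2 * Ke ^ 2 * ∫ ω, ‖e 0 ω‖ ^ 2 ∂P + ∫ ω, ‖e 0 ω‖ ^ 4 ∂P := by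
    rw [h2, Matrix.trace_add, Matrix.trace_sub, Matrix.trace_smul, Matrix.trace_smul,
      trace_covMatrix hmeas hbound hmean, trace_matrixExp_outer_sq hmeas hbound]
    simp [mul_comm]
  have h4 : 0 ≤ Ke ^ 4 - 2 * Ke ^ 2 * ∫ ω, ‖e 0 ω‖ ^ 2 ∂P + ∫ ω, ‖e 0 ω‖ ^ 4 ∂P := by
    have h : 0 ≤ ∫ ω, (Ke ^ 4 - 2 * Ke ^ 2 * ‖e 0 ω‖ ^ 2 + ‖e 0 ω‖ ^ 4) ∂P :=
      integral_nonneg fun ω => by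
        have : Ke ^ 4 - 2 * Ke ^ 2 * ‖e 0 ω‖ ^ 2 + ‖e 0 ω‖ ^ 4 = (Ke ^ 2 - ‖e 0 ω‖ ^ 2) ^ 2 := by
          ring
        rw [this]
        exact sq_nonneg _
    have i3 : Integrable (fun ω => Ke ^ 4 - 2 * Ke ^ 2 * ‖e 0 ω‖ ^ 2) P :=
      (integrable_const _).sub (i2.const_mul _)
    rw [integral_add i3 i4, integral_sub (integrable_const _) (i2.const_mul _),
      integral_const_mul] at h
    simpa using h
  have h5 := trace_le_norm B
  have hq' : (2 : ℝ) ≤ q := by exact_mod_cast hq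
  have hK : 0 ≤ Ke ^ 4 := by positivity
  rw [h1]
  gcongr
  have h6 : q * (Ke ^ 4 / 2) ≤ q * ‖B‖ := by nlinarith
  exact le_of_mul_le_mul_left h6 (by linarith)

/-- The radial scaling by `K⁻¹`, with the vectors that leave the unit ball sent to `0`. -/
noncomputable def toUnitBall (K : ℝ) (v : EuclideanSpace ℝ (Fin q)) :
    Metric.closedBall (0 : EuclideanSpace ℝ (Fin q)) 1 :=
  open Classical in if h : ‖K⁻¹ • v‖ ≤ 1 then ⟨K⁻¹ • v, mem_closedBall_zero_iff.2 h⟩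
  else ⟨0, Metric.mem_closedBall_self zero_le_one⟩

theorem measurable_toUnitBall (K : ℝ) :
    Measurable (toUnitBall K : EuclideanSpace ℝ (Fin q) → _) := by
  refine (MeasurableEmbedding.subtype_coe
    Metric.isClosed_closedBall.measurableSet).measurable_comp_iff.1 ?_
  have : (Subtype.val ∘ toUnitBall K : EuclideanSpace ℝ (Fin q) → _) =
      Set.indicator {v | ‖K⁻¹ • v‖ ≤ 1} (fun v => K⁻¹ • v) := by
    ext1 v
    by_cases h : ‖K⁻¹ • v‖ ≤ 1 <;> simp [toUnitBall, Set.indicator, h]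
  rw [this]
  exact (measurable_const_smul _).indicator
    (measurableSet_le (measurable_const_smul _).norm measurable_const)

theorem smul_toUnitBall {K : ℝ} (hK : 0 < K) {v : EuclideanSpace ℝ (Fin q)} (hv : ‖v‖ ≤ K) :
    K • (toUnitBall K v : EuclideanSpace ℝ (Fin q)) = v := by
  have h : ‖K⁻¹ • v‖ ≤ 1 := by
    rw [norm_smul, norm_inv, Real.norm_of_nonneg hK.le, inv_mul_le_iff₀ hK]
    simpa using hv
  rw [toUnitBall, dif_pos h, smul_inv_smul₀ hK.ne']

theorem outer_eq_smul_toUnitBall {K : ℝ} (hK : 0 < K) {v : EuclideanSpace ℝ (Fin q)}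
    (hv : ‖v‖ ≤ K) :
    outer v = K ^ 2 • outer (toUnitBall K v : EuclideanSpace ℝ (Fin q)) := by
  rw [← outer_smul, smul_toUnitBall hK hv]

theorem continuous_outer_coe : Continuous fun v : Metric.closedBall (0 : EuclideanSpace ℝ (Fin q)) 1
    => outer (v : EuclideanSpace ℝ (Fin q)) :=
  continuous_outer.comp continuous_subtype_val

theorem covMatrix_eq_smul_integral {X : Ω → EuclideanSpace ℝ (Fin q)} {K : ℝ} (hK : 0 < K)
    (hm : Measurable X) (hb : ∀ᵐ ω ∂P, ‖X ω‖ ≤ K) (h0 : ∫ ω, X ω ∂P = 0) :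
    covMatrix P X = K ^ 2 • ∫ v : Metric.closedBall (0 : EuclideanSpace ℝ (Fin q)) 1,
      outer (v : EuclideanSpace ℝ (Fin q)) ∂(P.map fun ω => toUnitBall K (X ω)) := by
  have hZ : Measurable fun ω => toUnitBall K (X ω) := (measurable_toUnitBall K).comp hm
  have := Measure.isProbabilityMeasure_map (μ := P) hZ.aemeasurable
  ext i j
  -- Entries are continuous linear functionals, so the Bochner mean agrees with the entrywise one.
  have hent := (LinearMap.toContinuousLinearMap (Matrix.entryLinearMap ℝ ℝ i j)).integral_comp_comm
    (integrable_of_continuous (continuous_outer_coe (q := q)) (P.map fun ω => toUnitBall K (X ω)))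
  have hent' : ∫ v : Metric.closedBall (0 : EuclideanSpace ℝ (Fin q)) 1,
      outer (v : EuclideanSpace ℝ (Fin q)) i j ∂(P.map fun ω => toUnitBall K (X ω)) =
      (∫ v : Metric.closedBall (0 : EuclideanSpace ℝ (Fin q)) 1,
      outer (v : EuclideanSpace ℝ (Fin q)) ∂(P.map fun ω => toUnitBall K (X ω))) i j := hent
  rw [covMatrix_apply hm hb h0, Matrix.smul_apply, ← hent', smul_eq_mul, ← integral_const_mul,
    integral_map hZ.aemeasurable
      ((continuous_outer_coe.matrix_elem i j).const_mul _).aestronglyMeasurable]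
  refine integral_congr_ae ?_
  filter_upwards [hb] with ω hω
  rw [outer_eq_smul_toUnitBall hK hω]
  rfl

theorem measureReal_norm_Phi3_ge_le {e : ℤ → Ω → EuclideanSpace ℝ (Fin q)} {Ke : ℝ}
    (hK : 0 < Ke) (hmeas : ∀ n, Measurable (e n)) (hindep : iIndepFun e P)
    (hident : ∀ n, IdentDistrib (e n) (e 0) P P) (hbound : ∀ n, ∀ᵐ ω ∂P, ‖e n ω‖ ≤ Ke)
    (hmean : ∫ ω, e 0 ω ∂P = 0) (k' : ℕ) {N : ℕ} (hN : 1 ≤ N) {t : ℝ} (ht : 0 < t) :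
    P.real {ω | t ≤ ‖Phi3 P e k' N ω‖} ≤ 2 * q * Real.exp (-2 * N * t ^ 2 / Ke ^ 4) := by
  have hN0 : (0 : ℝ) < N := by exact_mod_cast hN
  let g : Fin N → ℤ := fun i => (i : ℤ) - (k' : ℤ) - 1
  have hg : Function.Injective g := fun i j h => by
    ext
    simp only [g] at h
    omega
  let Z : Fin N → Ω → Metric.closedBall (0 : EuclideanSpace ℝ (Fin q)) 1 :=
    fun i ω => toUnitBall Ke (e (g i) ω)
  have hZm : ∀ i, Measurable (Z i) := fun i => (measurable_toUnitBall Ke).comp (hmeas _)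
  have hZ : iIndepFun Z P :=
    (hindep.precomp hg).comp (fun _ => toUnitBall Ke) fun _ => measurable_toUnitBall Ke
  set μ := P.map fun ω => toUnitBall Ke (e 0 ω) with hμ
  have : IsProbabilityMeasure μ :=
    Measure.isProbabilityMeasure_map ((measurable_toUnitBall Ke).comp (hmeas 0)).aemeasurable
  have hlaw : ∀ i, P.map (Z i) = μ := fun i =>
    ((hident (g i)).comp (measurable_toUnitBall Ke)).map_eq
  have hmap : P.map (fun ω i => Z i ω) = Measure.pi fun _ => μ := by
    rw [hZ.map_fun_eq_pi_map fun i => (hZm i).aemeasurable]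
    simp only [hlaw]
  set m := ∫ v : Metric.closedBall (0 : EuclideanSpace ℝ (Fin q)) 1,
      outer (v : EuclideanSpace ℝ (Fin q)) ∂μ with hm
  have hcov : covMatrix P (e 0) = Ke ^ 2 • m :=
    covMatrix_eq_smul_integral hK (hmeas 0) (hbound 0) hmean
  set s := N * t / Ke ^ 2 with hs
  have hs0 : 0 < s := by positivity
  have hH := measureReal_norm_sum_sub_integral_ge_le μ (continuous_outer_coe (q := q))
    (fun v => outer_nonneg _) (fun v => outer_le_one (mem_closedBall_zero_iff.1 v.2)) hN hs0
  rw [← hmap, map_measureReal_apply (measurable_pi_lambda _ hZm)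
    (measurableSet_le measurable_const (by
      refine Continuous.measurable (continuous_norm.comp (continuous_finsetSum _ fun i _ => ?_))
      exact (continuous_outer_coe.comp (continuous_apply i)).sub continuous_const)),
    Fintype.card_fin] at hH
  have hexp : -2 * s ^ 2 / N = -2 * N * t ^ 2 / Ke ^ 4 := by
    rw [hs]
    field_simp
  rw [hexp] at hH
  refine le_trans (le_of_eq (measureReal_congr ?_)) hH
  -- Off this null set the truncation in `toUnitBall` is inactive and the two events coincide.
  have hall : ∀ᵐ ω ∂P, ∀ n, ‖e n ω‖ ≤ Ke := ae_all_iff.2 hbound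
  filter_upwards [hall] with ω hω
  have hPhi : Phi3 P e k' N ω =
      (Ke ^ 2 / N) • ∑ i : Fin N, (outer (Z i ω : EuclideanSpace ℝ (Fin q)) - m) := by
    rw [Phi3, hcov, ← Fin.sum_univ_eq_sum_range
      (fun n => outer (e ((n : ℤ) - (k' : ℤ) - 1) ω) - Ke ^ 2 • m) N, one_div,
      div_eq_inv_mul, mul_smul, Finset.smul_sum (r := Ke ^ 2)]
    congr 1
    refine Finset.sum_congr rfl fun i _ => ?_
    rw [smul_sub, ← outer_eq_smul_toUnitBall hK (hω _)]
  have hiff : t ≤ ‖Phi3 P e k' N ω‖ ↔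
      s ≤ ‖∑ i : Fin N, (outer (Z i ω : EuclideanSpace ℝ (Fin q)) - m)‖ := by
    rw [hPhi, norm_smul, Real.norm_of_nonneg (by positivity), hs, div_mul_eq_mul_div,
      le_div_iff₀ hN0, div_le_iff₀ (by positivity), mul_comm t, mul_comm (Ke ^ 2)]
  exact propext hiff

theorem measureReal_norm_Phi3_ge_eq_zero {e : ℤ → Ω → EuclideanSpace ℝ (Fin q)}
    (hmeas : ∀ n, Measurable (e n)) (hzero : ∀ n, ∀ᵐ ω ∂P, e n ω = 0)
    (k' N : ℕ) {t : ℝ} (ht : 0 < t) :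
    P.real {ω | t ≤ ‖Phi3 P e k' N ω‖} = 0 := by
  have h0 : outer (0 : EuclideanSpace ℝ (Fin q)) = 0 := by ext i j; simp [outer_apply]
  have hcov : covMatrix P (e 0) = 0 := by
    have hb : ∀ᵐ ω ∂P, ‖e 0 ω‖ ≤ 0 := by
      filter_upwards [hzero 0] with ω h
      simp [h]
    ext i j
    rw [covMatrix_apply (hmeas 0) hb (integral_eq_zero_of_ae (hzero 0))]
    refine integral_eq_zero_of_ae ?_
    filter_upwards [hzero 0] with ω h
    simp [h, h0]
  have hall : ∀ᵐ ω ∂P, ∀ n, e n ω = 0 := ae_all_iff.2 hzero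
  rw [measureReal_eq_zero_iff]
  refine measure_eq_zero_iff_ae_notMem.2 ?_
  filter_upwards [hall] with ω hω
  simp [Phi3, hcov, hω, h0, ht]

end Watermark

end DynamicWatermark

/-- If `c3 = 0`, division by zero makes the exponential `1`, the right reading only at `t = 0`; the
second conjunct supplies the reading `0` for `t > 0`. -/
theorem mainTheorem6 {Ω : Type*} [MeasurableSpace Ω] (P : Measure Ω) [IsProbabilityMeasure P]
    (q : ℕ) (hq : 2 ≤ q) (e : ℤ → Ω → EuclideanSpace ℝ (Fin q)) (Ke : ℝ)
    (hmeas : ∀ n, Measurable (e n))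
    (hindep : iIndepFun e P)
    (hident : ∀ n, IdentDistrib (e n) (e 0) P P)
    (hbound : ∀ n, ∀ᵐ ω ∂P, ‖e n ω‖ ≤ Ke)
    (hmean : ∀ n, ∫ ω, e n ω ∂P = 0)
    (k' N : ℕ) (hN : 1 ≤ N) :
    (∀ t : ℝ, 0 ≤ t →
      P.real {ω | t ≤ ‖DynamicWatermark.Phi3 P e k' N ω‖} ≤
        2 * (q : ℝ) * Real.exp (-((N : ℝ) ^ 2 * t ^ 2) / DynamicWatermark.c3 P e Ke N)) ∧
    (DynamicWatermark.c3 P e Ke N = 0 → ∀ t : ℝ, 0 < t →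
      P.real {ω | t ≤ ‖DynamicWatermark.Phi3 P e k' N ω‖} = 0) := by
  have hN0 : (0 : ℝ) < N := by exact_mod_cast hN
  have hq' : (2 : ℝ) ≤ q := by exact_mod_cast hq
  have hK : 0 ≤ Ke := by
    obtain ⟨ω, hω⟩ := (hbound 0).exists
    exact (norm_nonneg _).trans hω
  have hc := DynamicWatermark.c3_lower_bound hq (hmeas 0) hident (hbound 0) (hmean 0) N
  have hdeg : Ke = 0 → ∀ t : ℝ, 0 < t →
      P.real {ω | t ≤ ‖DynamicWatermark.Phi3 P e k' N ω‖} = 0 := fun h t ht =>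
    DynamicWatermark.measureReal_norm_Phi3_ge_eq_zero hmeas
      (fun n => (hbound n).mono fun ω hω => norm_le_zero_iff.1 (h ▸ hω)) k' N ht
  refine ⟨fun t ht => ?_, fun h => hdeg ?_⟩
  · rcases ht.eq_or_lt with rfl | ht
    · refine measureReal_le_one.trans ?_
      simp only [ne_eq, OfNat.ofNat_ne_zero, not_false_eq_true, zero_pow, mul_zero, neg_zero,
        zero_div, Real.exp_zero, mul_one]
      linarith
    -- If `Ke = 0` the watermark vanishes almost surely, and the event is null.
    rcases hK.eq_or_lt with h | hK
    · rw [hdeg h.symm t ht]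
      positivity
    refine (DynamicWatermark.measureReal_norm_Phi3_ge_le hK hmeas hindep hident hbound (hmean 0)
      k' hN ht).trans ?_
    refine mul_le_mul_of_nonneg_left (Real.exp_le_exp.2 ?_) (by positivity)
    have h1 : 0 < N * (Ke ^ 4 / 2) := by positivity
    have h2 : -2 * N * t ^ 2 / Ke ^ 4 = -((N : ℝ) ^ 2 * t ^ 2 / (N * (Ke ^ 4 / 2))) := by
      field_simp
    have h3 : 0 < DynamicWatermark.c3 P e Ke N := h1.trans_le hc
    rw [h2, neg_div, neg_le_neg_iff]
    gcongr
  -- By the lower bound, `c3 = 0` forces `Ke = 0`.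
  · by_contra hne
    have : 0 < N * (Ke ^ 4 / 2) := by positivity
    linarith
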